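/- An integral domain $D$ with quotient field $K$ is called a $v$-domain if $(AA^{-1})^{-1} = D$ for every nonzero finitely generated ideal $A$ of $D$, where $I^{-1} = \{x \in K : xI \subseteq D\}$ for a nonzero fractional ideal $I$ of $D$. It is called a super $v$-domain if the quotient ring (ring of fractions) $D_S$ is a $v$-domain for every multiplicative set $S$ of $D$ with $0 \notin S$. Let $D$ be an integral domain and let $X$ be an indeterminate over $D$. Then $D$ is a super $v$-domain if and only if the polynomial ring $D[X]$ is a super $v$-domain. -/

import Mathlib

open scoped nonZeroDivisors Polynomial

/-- An integral domain `D` with quotient field `K` is a `v`-domain if every nonzero finitely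
generated ideal `A` of `D` is `v`-invertible, that is, `(A A⁻¹)⁻¹ = D` as fractional ideals of `D`
in `K`. Here `I⁻¹ = (D :_K I) = {x ∈ K | x I ⊆ D}` for a nonzero fractional ideal `I`, and the
fractional ideal `D` is the unit `1`. -/
def IsVDomain (D : Type*) [CommRing D] [IsDomain D] : Prop :=
  ∀ A : Ideal D, A ≠ ⊥ → A.FG →
    ((A : FractionalIdeal D⁰ (FractionRing D)) *
      (A : FractionalIdeal D⁰ (FractionRing D))⁻¹)⁻¹ = 1

/-- An integral domain `D` is a super `v`-domain if every quotient ring (ring of fractions) `D_S`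
of `D` is a `v`-domain, where `S` runs over the multiplicative sets of `D` that do not contain `0`
(equivalently, the submonoids consisting of non-zero-divisors). -/
def IsSuperVDomain (D : Type*) [CommRing D] [IsDomain D] : Prop :=
  ∀ (S : Submonoid D) (hS : S ≤ D⁰),
    haveI : IsDomain (Localization S) := IsLocalization.isDomain_localization hS
    IsVDomain (Localization S)

/-! The property is turned into divisibility in `D` with a multiplier from `S`, so `D` and `D[X]`
are compared without fractional ideals. Descent from `D[X]` uses `S.map C` and reads off
coefficients. For ascent, fix `T` in `D[X]` and a fraction multiplying `s s⁻¹` into the localization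
at `T`. Dividing `s` by its gcd over the quotient field makes its span contain a constant `e ≠ 0`,
so up to `T` the fraction is `g / e`. If no element of `T` clears `e`, a prime `Q` disjoint from `T`
contains `(e : g)`. Let `P = Q ∩ D`. Since `D` is integrally closed, Kronecker's lemma passes to
coefficients, and the hypothesis on `D` at `P` gives `u ∉ P` with `e ∣ u g`, a contradiction. -/

/-- Every nonzero finitely generated ideal of `D` becomes `v`-invertible in the localization at `S`,
expressed by divisibility: a fraction `p / q` that multiplies `s s⁻¹` into the localization, for
`s` a finite set of generators, lies in the localization. -/
def IsVDomainAt (D : Type*) [CommRing D] (S : Submonoid D) : Prop :=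
  ∀ s : Finset D, (∃ a ∈ s, a ≠ 0) → ∀ p q : D, q ≠ 0 →
    (∀ m n : D, n ≠ 0 → (∀ a ∈ s, n ∣ m * a) → ∀ a ∈ s, ∃ t ∈ S, q * n ∣ t * (p * m * a)) →
    ∃ t ∈ S, q ∣ t * p

theorem exists_common_dvd_mul {D ι : Type*} [CommRing D] (S : Submonoid D) (s : Finset ι) (b : D)
    (f : ι → D) (h : ∀ i ∈ s, ∃ t ∈ S, b ∣ t * f i) : ∃ t ∈ S, ∀ i ∈ s, b ∣ t * f i := by
  classical
  choose! t ht using h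
  refine ⟨∏ i ∈ s, t i, prod_mem fun i hi => (ht i hi).1, fun i hi => ?_⟩
  exact (ht i hi).2.trans (mul_dvd_mul_right (Finset.dvd_prod_of_mem t hi) _)

/-! ### Fractional ideals in terms of divisibility -/

theorem algebraMap_div_mem_one_iff {D K : Type*} [CommRing D] [IsDomain D] [Field K] [Algebra D K]
    [IsFractionRing D K] {p q : D} (hq : q ≠ 0) :
    algebraMap D K p / algebraMap D K q ∈ (1 : FractionalIdeal D⁰ K) ↔ q ∣ p := by
  have hq' : algebraMap D K q ≠ 0 := by simpa using hq
  rw [FractionalIdeal.mem_one_iff]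
  constructor
  · rintro ⟨x, hx⟩
    refine ⟨x, IsFractionRing.injective D K ?_⟩
    rw [map_mul, hx]
    field_simp
  · rintro ⟨x, rfl⟩
    refine ⟨x, ?_⟩
    rw [map_mul]
    field_simp

theorem algebraMap_mul_mem_one {D K : Type*} [CommRing D] [IsDomain D] [Field K] [Algebra D K]
    [IsFractionRing D K] (r : D) {z : K} (hz : z ∈ (1 : FractionalIdeal D⁰ K)) :
    algebraMap D K r * z ∈ (1 : FractionalIdeal D⁰ K) := by
  obtain ⟨x, rfl⟩ := (FractionalIdeal.mem_one_iff _).1 hz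
  exact (FractionalIdeal.mem_one_iff _).2 ⟨r * x, map_mul _ _ _⟩

theorem mem_inv_coeIdeal_span_iff {D K : Type*} [CommRing D] [IsDomain D] [Field K] [Algebra D K]
    [IsFractionRing D K] {s : Set D} (hs : Ideal.span s ≠ ⊥) {y : K} :
    y ∈ ((Ideal.span s : Ideal D) : FractionalIdeal D⁰ K)⁻¹ ↔
      ∀ a ∈ s, y * algebraMap D K a ∈ (1 : FractionalIdeal D⁰ K) := by
  rw [FractionalIdeal.mem_inv_iff (by simpa using hs)]
  constructor
  · intro h a ha
    exact h _ (FractionalIdeal.mem_coeIdeal_of_mem _ (Ideal.subset_span ha))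
  · intro h z hz
    obtain ⟨x, hx, rfl⟩ := (FractionalIdeal.mem_coeIdeal _).1 hz
    induction hx using Submodule.span_induction with
    | mem x hx => exact h x hx
    | zero => simp [FractionalIdeal.zero_mem]
    | add x y _ _ hx hy =>
      rw [map_add, mul_add]
      exact Submodule.add_mem _ (hx (FractionalIdeal.mem_coeIdeal_of_mem _ ‹_›))
        (hy (FractionalIdeal.mem_coeIdeal_of_mem _ ‹_›))
    | smul r x _ hx =>
      rw [smul_eq_mul, map_mul, mul_left_comm]
      exact algebraMap_mul_mem_one r (hx (FractionalIdeal.mem_coeIdeal_of_mem _ ‹_›))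

theorem mem_inv_mul_inv_iff {D K : Type*} [CommRing D] [IsDomain D] [Field K] [Algebra D K]
    [IsFractionRing D K] {s : Set D} (hs : Ideal.span s ≠ ⊥) {x : K} :
    x ∈ (((Ideal.span s : Ideal D) : FractionalIdeal D⁰ K) *
        ((Ideal.span s : Ideal D) : FractionalIdeal D⁰ K)⁻¹)⁻¹ ↔
      ∀ y ∈ ((Ideal.span s : Ideal D) : FractionalIdeal D⁰ K)⁻¹,
        ∀ a ∈ s, x * y * algebraMap D K a ∈ (1 : FractionalIdeal D⁰ K) := by
  set A : FractionalIdeal D⁰ K := ((Ideal.span s : Ideal D) : FractionalIdeal D⁰ K) with hA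
  have hA0 : A ≠ 0 := by simpa [hA] using hs
  have hAA : A * A⁻¹ ≠ 0 := by
    have h : A ≤ A * A⁻¹ := FractionalIdeal.coe_ideal_le_self_mul_inv K _
    intro h0
    rw [h0] at h
    exact hA0 (le_antisymm h (FractionalIdeal.zero_le _))
  rw [FractionalIdeal.mem_inv_iff hAA]
  constructor
  · intro h y hy a ha
    rw [mul_assoc, mul_comm y]
    exact h _ (FractionalIdeal.mul_mem_mul
      (FractionalIdeal.mem_coeIdeal_of_mem _ (Ideal.subset_span ha)) hy)
  · intro h z hz
    refine FractionalIdeal.mul_induction_on hz (fun i hi j hj => ?_) fun i j hi hj => ?_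
    · have : x * j ∈ A⁻¹ := (mem_inv_coeIdeal_span_iff hs).2 (h j hj)
      rw [mul_comm i, ← mul_assoc]
      exact (FractionalIdeal.mem_inv_iff hA0).1 this i hi
    · rw [mul_add]
      exact Submodule.add_mem _ hi hj

theorem isVDomain_iff_isVDomainAt_bot (D : Type*) [CommRing D] [IsDomain D] :
    IsVDomain D ↔ IsVDomainAt D ⊥ := by
  classical
  have one_le (s : Set D) (hs : Ideal.span s ≠ ⊥) : (1 : FractionalIdeal D⁰ (FractionRing D)) ≤
      (((Ideal.span s : Ideal D) : FractionalIdeal D⁰ (FractionRing D)) *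
        ((Ideal.span s : Ideal D) : FractionalIdeal D⁰ (FractionRing D))⁻¹)⁻¹ := by
    intro x hx
    obtain ⟨r, rfl⟩ := (FractionalIdeal.mem_one_iff _).1 hx
    refine (mem_inv_mul_inv_iff hs).2 fun y hy a ha => ?_
    rw [mul_assoc]
    exact algebraMap_mul_mem_one r ((mem_inv_coeIdeal_span_iff hs).1 hy a ha)
  have key (s : Finset D) (hs : Ideal.span (s : Set D) ≠ ⊥) (p q : D) (hq : q ≠ 0) :
      (algebraMap D (FractionRing D) p / algebraMap D (FractionRing D) q ∈
        (((Ideal.span (s : Set D) : Ideal D) : FractionalIdeal D⁰ (FractionRing D)) *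
        ((Ideal.span (s : Set D) : Ideal D) : FractionalIdeal D⁰ (FractionRing D))⁻¹)⁻¹) ↔
      ∀ m n : D, n ≠ 0 → (∀ a ∈ s, n ∣ m * a) → ∀ a ∈ s, q * n ∣ p * m * a := by
    have e1 (m n a : D) : algebraMap D (FractionRing D) m / algebraMap D (FractionRing D) n *
        algebraMap D (FractionRing D) a =
        algebraMap D (FractionRing D) (m * a) / algebraMap D (FractionRing D) n := by
      rw [map_mul]; ring
    have e2 (m n a : D) : algebraMap D (FractionRing D) p / algebraMap D (FractionRing D) q *
        (algebraMap D (FractionRing D) m / algebraMap D (FractionRing D) n) *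
        algebraMap D (FractionRing D) a =
        algebraMap D (FractionRing D) (p * m * a) / algebraMap D (FractionRing D) (q * n) := by
      rw [map_mul, map_mul, map_mul, div_mul_div_comm]; ring
    rw [mem_inv_mul_inv_iff hs]
    constructor
    · intro h m n hn hm a ha
      have := h (algebraMap D _ m / algebraMap D _ n) ((mem_inv_coeIdeal_span_iff hs).2
        fun a ha => by rw [e1, algebraMap_div_mem_one_iff hn]; exact hm a ha) a ha
      rwa [e2, algebraMap_div_mem_one_iff (mul_ne_zero hq hn)] at this
    · intro h y hy a ha
      obtain ⟨m, n, hn, rfl⟩ := IsFractionRing.div_surjective (A := D) y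
      have hn := nonZeroDivisors.ne_zero hn
      rw [e2, algebraMap_div_mem_one_iff (mul_ne_zero hq hn)]
      refine h m n hn (fun a ha => ?_) a ha
      have := (mem_inv_coeIdeal_span_iff hs).1 hy a ha
      rwa [e1, algebraMap_div_mem_one_iff hn] at this
  have span_ne_bot_iff (s : Finset D) : Ideal.span (s : Set D) ≠ ⊥ ↔ ∃ a ∈ s, a ≠ 0 := by
    simp
  constructor
  · intro h s hs p q hq H
    have hs := (span_ne_bot_iff s).2 hs
    have := h (Ideal.span s) hs ⟨s, rfl⟩
    refine ⟨1, one_mem _, ?_⟩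
    rw [one_mul, ← algebraMap_div_mem_one_iff (K := FractionRing D) hq, ← this, key s hs p q hq]
    intro m n hn hm a ha
    obtain ⟨t, ht, h⟩ := H m n hn hm a ha
    rwa [Submonoid.mem_bot.1 ht, one_mul] at h
  · rintro h A hA ⟨s, rfl⟩
    refine le_antisymm (fun x hx => ?_) (one_le _ hA)
    obtain ⟨p, q, hq, rfl⟩ := IsFractionRing.div_surjective (A := D) x
    have hq := nonZeroDivisors.ne_zero hq
    have hx := (key s hA p q hq).1 hx
    obtain ⟨t, ht, h⟩ := h s ((span_ne_bot_iff s).1 hA) p q hq fun m n hn hm a ha =>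
      ⟨1, one_mem _, by simpa using hx m n hn hm a ha⟩
    rw [Submonoid.mem_bot.1 ht, one_mul] at h
    exact (algebraMap_div_mem_one_iff hq).2 h

/-! ### Localization -/

theorem IsLocalization.algebraMap_dvd_iff {D L : Type*} [CommRing D] [CommRing L] [Algebra D L]
    (S : Submonoid D) [IsLocalization S L] {b a : D} :
    algebraMap D L b ∣ algebraMap D L a ↔ ∃ t ∈ S, b ∣ t * a := by
  constructor
  · rintro ⟨z, hz⟩
    obtain ⟨⟨x, u⟩, hx⟩ := IsLocalization.surj S z
    have : algebraMap D L (u * a) = algebraMap D L (b * x) := by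
      rw [map_mul, map_mul, hz, ← hx]; ring
    obtain ⟨c, hc⟩ := (IsLocalization.eq_iff_exists S L).1 this
    exact ⟨c * u, mul_mem c.2 u.2, c * x, by linear_combination hc⟩
  · rintro ⟨t, ht, h⟩
    have := map_dvd (algebraMap D L) h
    rw [map_mul] at this
    exact (IsLocalization.map_units L ⟨t, ht⟩).dvd_mul_left.1 this

theorem IsLocalization.exists_associated_algebraMap {D L : Type*} [CommRing D] [CommRing L]
    [Algebra D L] (S : Submonoid D) [IsLocalization S L] (z : L) :
    ∃ x : D, Associated z (algebraMap D L x) := by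
  obtain ⟨⟨x, u⟩, hx⟩ := IsLocalization.surj S z
  obtain ⟨w, hw⟩ := IsLocalization.map_units L u
  exact ⟨x, w, by rw [hw, hx]⟩

/-- Divisibility ignores units, and every element of `L` is associated to one from `D`, so all data
can be taken in `D`. -/
theorem isVDomainAt_bot_localization_iff {D L : Type*} [CommRing D] [IsDomain D] [CommRing L]
    [Algebra D L] {S : Submonoid D} (hS : S ≤ D⁰) [IsLocalization S L] :
    IsVDomainAt L ⊥ ↔ IsVDomainAt D S := by
  classical
  have inj : Function.Injective (algebraMap D L) := IsLocalization.injective L hS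
  constructor
  · rintro h s ⟨a, ha, ha0⟩ p q hq H
    rw [← IsLocalization.algebraMap_dvd_iff (L := L) S]
    have key := h (s.image (algebraMap D L))
      ⟨_, Finset.mem_image_of_mem _ ha, by simpa [map_eq_zero_iff _ inj] using ha0⟩
      (algebraMap D L p) (algebraMap D L q) (by simpa [map_eq_zero_iff _ inj] using hq) ?_
    · obtain ⟨t, ht, h⟩ := key
      rwa [Submonoid.mem_bot.1 ht, one_mul] at h
    intro m n hn hm b hb
    obtain ⟨b, hbs, rfl⟩ := Finset.mem_image.1 hb
    obtain ⟨m', hm'⟩ := IsLocalization.exists_associated_algebraMap S m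
    obtain ⟨n', hn'⟩ := IsLocalization.exists_associated_algebraMap S n
    refine ⟨1, one_mem _, ?_⟩
    rw [one_mul, (hn'.mul_left _).dvd_iff_dvd_left,
      ((hm'.mul_left _).mul_right _).dvd_iff_dvd_right]
    have hn0 : n' ≠ 0 := by
      rintro rfl
      exact hn (by simpa using hn')
    obtain ⟨v, hv, hvs⟩ := exists_common_dvd_mul S s n' (fun a => m' * a) fun a ha => by
      rw [← IsLocalization.algebraMap_dvd_iff (L := L) S, map_mul, ← hn'.dvd_iff_dvd_left,
        ← (hm'.mul_right _).dvd_iff_dvd_right]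
      exact hm _ (Finset.mem_image_of_mem _ ha)
    -- The factor `v ∈ S` turns divisibility in `L` into divisibility in `D`.
    obtain ⟨t, ht, h⟩ := H (v * m') n' hn0 (fun a ha => by rw [mul_assoc]; exact hvs a ha) b hbs
    rw [← map_mul, ← map_mul, ← map_mul, IsLocalization.algebraMap_dvd_iff S]
    exact ⟨t * v, mul_mem ht hv, by convert h using 1; ring⟩
  · rintro h s ⟨a, ha, ha0⟩ p q hq H
    choose num hnum using IsLocalization.exists_associated_algebraMap (L := L) S
    have num0 {z : L} (hz : z ≠ 0) : num z ≠ 0 := by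
      intro h0
      have := hnum z
      rw [h0] at this
      exact hz (by simpa using this)
    refine ⟨1, one_mem _, ?_⟩
    rw [one_mul, (hnum q).dvd_iff_dvd_left, (hnum p).dvd_iff_dvd_right,
      IsLocalization.algebraMap_dvd_iff S]
    refine h (s.image num) ⟨_, Finset.mem_image_of_mem _ ha, num0 ha0⟩ _ _ (num0 hq) ?_
    intro m n hn hm b hb
    obtain ⟨b, hbs, rfl⟩ := Finset.mem_image.1 hb
    obtain ⟨t, ht, h⟩ := H (algebraMap D L m) (algebraMap D L n)
      (by simpa [map_eq_zero_iff _ inj] using hn) (fun a ha => by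
        rw [((hnum a).mul_left _).dvd_iff_dvd_right, ← map_mul]
        exact map_dvd _ (hm _ (Finset.mem_image_of_mem _ ha))) b hbs
    rw [Submonoid.mem_bot.1 ht, one_mul, ((hnum q).mul_right _).dvd_iff_dvd_left,
      ((hnum b).mul_left _).dvd_iff_dvd_right,
      (((hnum p).mul_right _).mul_right _).dvd_iff_dvd_right, ← map_mul, ← map_mul, ← map_mul,
      IsLocalization.algebraMap_dvd_iff S] at h
    exact h

theorem isSuperVDomain_iff (D : Type*) [CommRing D] [IsDomain D] :
    IsSuperVDomain D ↔ ∀ S : Submonoid D, S ≤ D⁰ → IsVDomainAt D S := by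
  refine forall₂_congr fun S hS => ?_
  have : IsDomain (Localization S) := IsLocalization.isDomain_localization hS
  rw [isVDomain_iff_isVDomainAt_bot, isVDomainAt_bot_localization_iff hS]

/-! ### Gauss's and Kronecker's lemmas -/

open Polynomial

theorem exists_forall_map_coeff_le {K Γ : Type*} [CommRing K] [LinearOrderedCommGroupWithZero Γ]
    (v : Valuation K Γ) (f : K[X]) :
    ∃ i, (∀ j, v (f.coeff j) ≤ v (f.coeff i)) ∧ ∀ j < i, v (f.coeff j) < v (f.coeff i) := by
  classical
  have h : ∃ i, ∀ j, v (f.coeff j) ≤ v (f.coeff i) := by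
    obtain ⟨i, -, hi⟩ := Finset.exists_max_image (Finset.range (f.natDegree + 1))
      (fun j => v (f.coeff j)) ⟨0, by simp⟩
    refine ⟨i, fun j => ?_⟩
    by_cases hj : j < f.natDegree + 1
    · exact hi j (Finset.mem_range.2 hj)
    · rw [f.coeff_eq_zero_of_natDegree_lt (by omega), map_zero]
      exact zero_le
  refine ⟨Nat.find h, Nat.find_spec h, fun j hj => lt_of_not_ge fun hle => Nat.find_min h hj ?_⟩
  exact fun k => (Nat.find_spec h k).trans hle

/-- Gauss's lemma for a valuation. -/
theorem Valuation.map_coeff_mul_map_coeff_le {K Γ : Type*} [CommRing K]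
    [LinearOrderedCommGroupWithZero Γ] (v : Valuation K Γ) {f g : K[X]} {γ : Γ}
    (h : ∀ k, v ((f * g).coeff k) ≤ γ) (i j : ℕ) : v (f.coeff i) * v (g.coeff j) ≤ γ := by
  classical
  obtain ⟨i₀, hi, hi'⟩ := exists_forall_map_coeff_le v f
  obtain ⟨j₀, hj, hj'⟩ := exists_forall_map_coeff_le v g
  refine (mul_le_mul' (hi i) (hj j)).trans ?_
  by_cases hf : v (f.coeff i₀) = 0
  · simp [hf]
  by_cases hg : v (g.coeff j₀) = 0
  · simp [hg]
  -- As `i₀` and `j₀` are the first indices of maximal value, one term strictly dominates this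
  -- coefficient of the product.
  refine le_trans (le_of_eq ?_) (h (i₀ + j₀))
  have hmem : (i₀, j₀) ∈ Finset.HasAntidiagonal.antidiagonal (i₀ + j₀) := by simp
  rw [coeff_mul, ← Finset.add_sum_erase _ _ hmem, v.map_add_eq_of_lt_left, map_mul]
  rw [map_mul]
  refine v.map_sum_lt (mul_ne_zero hf hg) fun x hx => ?_
  obtain ⟨hne, hx⟩ := Finset.mem_erase.1 hx
  rw [Finset.HasAntidiagonal.mem_antidiagonal] at hx
  rw [map_mul]
  rcases lt_trichotomy x.1 i₀ with hlt | heq | hgt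
  · exact mul_lt_mul_of_lt_of_le_of_nonneg_of_pos (hi' _ hlt) (hj _) zero_le (zero_lt_iff.2 hg)
  · exact absurd (Prod.ext heq (by omega)) hne
  · exact mul_lt_mul_of_le_of_lt_of_nonneg_of_pos (hi _) (hj' _ (by omega)) zero_le (zero_lt_iff.2 hf)

/-- Kronecker's lemma on the coefficients of a product over an integrally closed domain. -/
theorem dvd_coeff_mul_coeff {D : Type*} [CommRing D] [IsDomain D] [IsIntegrallyClosed D]
    {f g : D[X]} {d : D} (h : ∀ k, d ∣ (f * g).coeff k) (i j : ℕ) :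
    d ∣ f.coeff i * g.coeff j := by
  by_cases hd : d = 0
  · subst hd
    have : f * g = 0 := by ext k; simpa using h k
    rcases mul_eq_zero.1 this with h | h <;> simp [h]
  let K := FractionRing D
  let R : Subring K := (algebraMap D K).range
  have hd' : algebraMap D K d ≠ 0 := by simpa using hd
  have : IsIntegrallyClosedIn R K := by
    rw [Subring.isIntegrallyClosedIn_iff]
    intro x hx
    have : IsIntegral D x := by
      obtain ⟨p, hp, hpx⟩ := hx
      have hsurj : Function.Surjective (algebraMap D K).rangeRestrict :=
        (algebraMap D K).rangeRestrict_surjective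
      obtain ⟨q, hq, -, hqm⟩ := Polynomial.lifts_and_natDegree_eq_and_monic
        (f := (algebraMap D K).rangeRestrict) (p := p)
        ((Polynomial.mem_lifts _).2 (Polynomial.map_surjective _ hsurj p)) hp
      refine ⟨q, hqm, ?_⟩
      rw [← hpx, ← hq, eval₂_map]
      rfl
    obtain ⟨y, hy⟩ := IsIntegrallyClosed.isIntegral_iff.1 this
    exact ⟨y, hy⟩
  by_contra hnot
  have hx : algebraMap D K (f.coeff i * g.coeff j) / algebraMap D K d ∉ R := by
    rintro ⟨y, hy⟩
    refine hnot ⟨y, IsFractionRing.injective D K ?_⟩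
    rw [map_mul _ d, hy, mul_div_cancel₀ _ hd']
  -- An integrally closed domain is an intersection of valuation rings, so Gauss's lemma for one
  -- omitting the quotient suffices.
  obtain ⟨V, hRV, hxV⟩ := Subring.exists_le_valuationSubring_of_isIntegrallyClosedIn hx
  refine hxV ?_
  rw [← V.valuation_le_one_iff, map_div₀, div_le_one₀ (by simpa [zero_lt_iff] using hd'), map_mul,
    map_mul]
  have := Valuation.map_coeff_mul_map_coeff_le V.valuation (f := f.map (algebraMap D K))
    (g := g.map (algebraMap D K)) (γ := V.valuation (algebraMap D K d)) (fun k => ?_) i j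
  · simpa using this
  · obtain ⟨c, hc⟩ := h k
    rw [← Polynomial.map_mul, coeff_map, hc, map_mul, map_mul]
    exact mul_le_of_le_one_right' ((V.valuation_le_one_iff _).2 (hRV ⟨c, rfl⟩))

/-- If `x` is integral, a finitely generated ideal `A` has `xA ⊆ A`, so `x` multiplies `A A⁻¹` into
`D`. -/
theorem IsVDomainAt.isIntegrallyClosed {D : Type*} [CommRing D] [IsDomain D]
    (h : IsVDomainAt D ⊥) : IsIntegrallyClosed D := by
  classical
  rw [isIntegrallyClosed_iff (FractionRing D)]
  intro x hx
  obtain ⟨p, q, hq, rfl⟩ := IsFractionRing.div_surjective (A := D) x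
  have hq := nonZeroDivisors.ne_zero hq
  have hq' : algebraMap D (FractionRing D) q ≠ 0 := by simpa using hq
  obtain ⟨P, hP, hPx⟩ := hx
  set n := P.natDegree with hn
  have hrel : p ^ n + ∑ i ∈ Finset.range n, P.coeff i * (p ^ i * q ^ (n - i)) = 0 := by
    apply IsFractionRing.injective D (FractionRing D)
    rw [eval₂_eq_sum_range, Finset.sum_range_succ, ← hn, hP.coeff_natDegree] at hPx
    have := congrArg (· * algebraMap D (FractionRing D) q ^ n) hPx
    simp only [zero_mul, add_mul, Finset.sum_mul, map_one, one_mul] at this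
    rw [map_zero, ← this, add_comm, map_add, map_sum]
    congr 1
    · refine Finset.sum_congr rfl fun i hi => ?_
      have hi := Finset.mem_range.1 hi
      rw [← Nat.add_sub_of_le hi.le, pow_add, Nat.add_sub_of_le hi.le, div_pow, map_mul, map_mul,
        map_pow, map_pow]
      field_simp
    · rw [map_pow, ← mul_pow, div_mul_cancel₀ _ hq']
  have hn0 : n ≠ 0 := by
    intro h0
    rw [h0] at hrel
    simp at hrel
  obtain ⟨l, hl⟩ := Nat.exists_eq_succ_of_ne_zero hn0
  -- The powers `1, x, …, x ^ l` of `x = p / q`, scaled by `q ^ l`, where `l = n - 1`.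
  let w : ℕ → D := fun i => p ^ i * q ^ (l - i)
  have key := h ((Finset.range n).image w)
    ⟨w 0, Finset.mem_image_of_mem _ (by simp [hl]), by simp [w, hq]⟩ p q hq ?_
  · obtain ⟨t, ht, hdvd⟩ := key
    rw [Submonoid.mem_bot.1 ht, one_mul] at hdvd
    obtain ⟨y, rfl⟩ := hdvd
    exact ⟨y, by rw [map_mul]; field_simp⟩
  intro m k hk hm a ha
  obtain ⟨i, hi, rfl⟩ := Finset.mem_image.1 ha
  have hi := Finset.mem_range.1 hi
  have hm (i : ℕ) (hi : i < n) : k ∣ m * w i :=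
    hm _ (Finset.mem_image_of_mem _ (Finset.mem_range.2 hi))
  refine ⟨1, one_mem _, ?_⟩
  rw [one_mul]
  by_cases hil : i < l
  · have : p * m * w i = q * (m * w (i + 1)) := by
      simp only [w]
      rw [show l - i = (l - (i + 1)) + 1 by omega]
      ring
    rw [this]
    exact mul_dvd_mul_left _ (hm _ (by omega))
  · have hi : i = l := by omega
    have : p * m * w i = q * ∑ i ∈ Finset.range n, -P.coeff i * (m * w i) := by
      have hsum : ∑ i ∈ Finset.range n, P.coeff i * (p ^ i * q ^ (n - i)) =
          q * ∑ i ∈ Finset.range n, P.coeff i * w i := by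
        rw [Finset.mul_sum]
        refine Finset.sum_congr rfl fun i hi => ?_
        have hi := Finset.mem_range.1 hi
        simp only [w]
        rw [show n - i = (l - i) + 1 by omega]
        ring
      have hsum' : ∑ i ∈ Finset.range n, -P.coeff i * (m * w i) =
          -m * ∑ i ∈ Finset.range n, P.coeff i * w i := by
        rw [Finset.mul_sum]
        exact Finset.sum_congr rfl fun i _ => by ring
      have hw : p * w i = p ^ n := by simp [w, hi, hl, pow_succ, mul_comm]
      rw [hsum] at hrel
      rw [hsum']
      linear_combination m * hw + m * hrel
    rw [this]
    exact mul_dvd_mul_left _ (Finset.dvd_sum fun i hi =>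
      (hm i (Finset.mem_range.1 hi)).mul_left _)

-- Passage between `D` and `D[X]`

attribute [local instance] Polynomial.algebra Polynomial.isLocalization in
/-- Dividing finitely many polynomials over `D` by their greatest common divisor over the quotient
field. -/
theorem exists_mul_eq_mul_and_C_mem_span {D : Type*} [CommRing D] [IsDomain D] (s : Finset D[X])
    (hs : ∃ f ∈ s, f ≠ 0) :
    ∃ (c d : D[X]) (r : D[X] → D[X]) (e : D), c ≠ 0 ∧ d ≠ 0 ∧ e ≠ 0 ∧
      (∀ f ∈ s, c * f = d * r f) ∧ C e ∈ Ideal.span (r '' (s : Set D[X])) := by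
  classical
  let K := FractionRing D
  let φ : D[X] →+* K[X] := algebraMap D[X] K[X]
  have hφ : Function.Injective φ := by
    have : φ = mapRingHom (algebraMap D K) := rfl
    rw [this]
    exact Polynomial.map_injective _ (IsFractionRing.injective D K)
  obtain ⟨d₀, hd₀⟩ := (IsPrincipalIdealRing.principal (Ideal.span (φ '' (s : Set D[X])))).principal
  rw [Ideal.submodule_span_eq] at hd₀
  have hdvd (f : D[X]) (hf : f ∈ s) : ∃ k, φ f = d₀ * k := by
    have : φ f ∈ Ideal.span {d₀} := hd₀ ▸ Ideal.subset_span ⟨f, hf, rfl⟩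
    exact Ideal.mem_span_singleton.1 this
  choose! k hk using hdvd
  have hd₀0 : d₀ ≠ 0 := by
    rintro rfl
    obtain ⟨f, hf, hf0⟩ := hs
    exact hf0 (hφ (by rw [hk f hf, zero_mul, map_zero]))
  have hmem : d₀ ∈ Ideal.span (φ '' (s : Set D[X])) := hd₀ ▸ Ideal.mem_span_singleton_self d₀
  have hone : (1 : K[X]) ∈ Ideal.span (k '' (s : Set D[X])) := by
    have : Ideal.span (φ '' (s : Set D[X])) ≤ Ideal.span {d₀} * Ideal.span (k '' (s : Set D[X])) := by
      rw [Ideal.span_le]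
      rintro _ ⟨f, hf, rfl⟩
      rw [hk f hf]
      exact Ideal.mul_mem_mul (Ideal.mem_span_singleton_self _) (Ideal.subset_span ⟨f, hf, rfl⟩)
    obtain ⟨z, hz, hz'⟩ := Ideal.mem_span_singleton_mul.1 (this hmem)
    rwa [mul_left_cancel₀ hd₀0 (hz'.trans (mul_one _).symm)] at hz
  have hCD (b : (D⁰).map (C : D →+* D[X])) : ∃ β : D, β ≠ 0 ∧ (b : D[X]) = C β := by
    obtain ⟨_, β, hβ, rfl⟩ := b
    exact ⟨β, nonZeroDivisors.ne_zero hβ, rfl⟩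
  obtain ⟨b, hb⟩ := IsLocalization.exist_integer_multiples ((D⁰).map (C : D →+* D[X])) s k
  obtain ⟨⟨d, b₁⟩, hd⟩ := IsLocalization.surj ((D⁰).map (C : D →+* D[X])) d₀
  choose! r hr using hb
  have hr' (f : D[X]) (hf : f ∈ s) : φ (r f) = φ b * k f := by
    have := hr f hf
    rwa [Algebra.smul_def] at this
  obtain ⟨β, hβ, hbβ⟩ := hCD b
  obtain ⟨β₁, hβ₁, hbβ₁⟩ := hCD b₁
  have hspan : φ b ∈ (Ideal.span (r '' (s : Set D[X]))).map φ := by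
    have : Ideal.span {φ b} * Ideal.span (k '' (s : Set D[X])) ≤
        (Ideal.span (r '' (s : Set D[X]))).map φ := by
      rw [Ideal.span_mul_span', Ideal.span_le]
      rintro _ ⟨_, rfl, _, ⟨f, hf, rfl⟩, rfl⟩
      simp only
      rw [← hr' f hf]
      exact Ideal.mem_map_of_mem _ (Ideal.subset_span ⟨f, hf, rfl⟩)
    have h1 := this (Ideal.mul_mem_mul (Ideal.mem_span_singleton_self _) hone)
    rwa [mul_one] at h1
  obtain ⟨⟨⟨x, hx⟩, b₂⟩, hb₂⟩ :=
    (IsLocalization.mem_map_algebraMap_iff ((D⁰).map (C : D →+* D[X])) K[X]).1 hspan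
  obtain ⟨β₂, hβ₂, hbβ₂⟩ := hCD b₂
  refine ⟨b * b₁, d, r, β * β₂, ?_, ?_, mul_ne_zero hβ hβ₂, fun f hf => ?_, ?_⟩
  · simp [hbβ, hbβ₁, hβ, hβ₁]
  · rintro rfl
    have h0 : d₀ * φ b₁ = 0 := by
      have h1 : d₀ * φ b₁ = φ 0 := hd
      rwa [map_zero] at h1
    rcases mul_eq_zero.1 h0 with h | h
    · exact hd₀0 h
    · rw [hbβ₁, map_eq_zero_iff _ hφ] at h
      exact hβ₁ (by simpa using h)
  · apply hφ
    have hd : d₀ * φ b₁ = φ d := hd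
    rw [map_mul, map_mul, map_mul, hr' f hf, hk f hf, ← hd]
    ring
  · have : b * b₂ = x := hφ (by rw [map_mul]; exact hb₂)
    rw [C_mul, ← hbβ, ← hbβ₂, this]
    exact hx

theorem IsVDomainAt.of_polynomial {D : Type*} [CommRing D] [IsDomain D] {S : Submonoid D}
    (h : IsVDomainAt D[X] (S.map C)) : IsVDomainAt D S := by
  classical
  rintro s ⟨a₀, ha₀, ha₀0⟩ p q hq H
  have key := h (s.image C)
    ⟨C a₀, Finset.mem_image_of_mem _ ha₀, by simpa using ha₀0⟩ (C p) (C q) (by simpa using hq) ?_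
  · obtain ⟨_, ⟨t, ht, rfl⟩, hdvd⟩ := key
    refine ⟨t, ht, ?_⟩
    rw [← C_mul] at hdvd
    simpa using (C_dvd_iff_dvd_coeff _ _).1 hdvd 0
  intro m n hn hm b hb
  obtain ⟨a, ha, rfl⟩ := Finset.mem_image.1 hb
  have hm (a : D) (ha : a ∈ s) : n ∣ m * C a := hm _ (Finset.mem_image_of_mem _ ha)
  -- Thus `m / n = g / a₀` has a constant denominator, and each `g.coeff k / a₀` lies in the inverse
  -- of the ideal of `D`.
  obtain ⟨g, hg⟩ := hm a₀ ha₀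
  have hga (a : D) (ha : a ∈ s) (k : ℕ) : a₀ ∣ g.coeff k * a := by
    rw [← coeff_mul_C]
    refine (C_dvd_iff_dvd_coeff _ _).1 ?_ k
    obtain ⟨w, hw⟩ := hm a ha
    refine ⟨w, mul_left_cancel₀ hn ?_⟩
    linear_combination -C a * hg + C a₀ * hw
  obtain ⟨t, ht, htk⟩ := exists_common_dvd_mul S (Finset.range (g.natDegree + 1)) (q * a₀)
    (fun k => p * g.coeff k * a) fun k _ => H _ a₀ ha₀0 (fun a ha => hga a ha k) a ha
  have hall : C (q * a₀) ∣ C t * (C p * g * C a) := by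
    rw [C_dvd_iff_dvd_coeff]
    intro k
    rw [coeff_C_mul, coeff_mul_C, coeff_C_mul]
    by_cases hk : k < g.natDegree + 1
    · exact htk k (Finset.mem_range.2 hk)
    · simp [g.coeff_eq_zero_of_natDegree_lt (show g.natDegree < k by omega)]
  refine ⟨C t, ⟨t, ht, rfl⟩, ?_⟩
  obtain ⟨w, hw⟩ := hall
  refine ⟨w, mul_left_cancel₀ (C_ne_zero.2 ha₀0) ?_⟩
  rw [C_mul] at hw
  linear_combination C t * C p * C a * hg + n * hw

theorem IsVDomainAt.polynomial {D : Type*} [CommRing D] [IsDomain D]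
    (hD : ∀ S : Submonoid D, S ≤ D⁰ → IsVDomainAt D S) (T : Submonoid D[X]) :
    IsVDomainAt D[X] T := by
  classical
  have : IsIntegrallyClosed D := (hD ⊥ bot_le).isIntegrallyClosed
  intro s hs p q hq H
  obtain ⟨c, d, r, e, hc, hd, he, hr, hspan⟩ := exists_mul_eq_mul_and_C_mem_span s hs
  have H (m n : D[X]) (hn : n ≠ 0) (hm : ∀ f ∈ s, n ∣ m * r f) :
      ∃ t ∈ T, ∀ f ∈ s, q * n ∣ t * (p * m * r f) := by
    refine exists_common_dvd_mul T s _ _ fun f hf => ?_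
    have key := H (m * c) (n * d) (mul_ne_zero hn hd) (fun f hf => ?_) f hf
    · obtain ⟨t, ht, h⟩ := key
      refine ⟨t, ht, (mul_dvd_mul_iff_right hd).1 ?_⟩
      convert h using 1
      · ring
      · linear_combination -t * p * m * hr f hf
    · have h : m * c * f = m * r f * d := by linear_combination m * hr f hf
      rw [h]
      exact mul_dvd_mul_right (hm f hf) d
  obtain ⟨t₀, ht₀, h₀⟩ := H 1 1 one_ne_zero fun f _ => one_dvd _
  obtain ⟨g, hg⟩ : q ∣ t₀ * p * C e := by
    have : Ideal.span (r '' (s : Set D[X])) ≤ (Ideal.span {q}).colon {t₀ * p} := by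
      rw [Ideal.span_le]
      rintro _ ⟨f, hf, rfl⟩
      rw [SetLike.mem_coe, Submodule.mem_colon_singleton, Ideal.mem_span_singleton]
      convert h₀ f hf using 1
      · ring
      · rw [smul_eq_mul]; ring
    have := this hspan
    rwa [Submodule.mem_colon_singleton, Ideal.mem_span_singleton, smul_eq_mul, mul_comm] at this
  suffices h : ∃ t ∈ T, C e ∣ t * g by
    obtain ⟨t, ht, w, hw⟩ := h
    refine ⟨t * t₀, mul_mem ht ht₀, w, mul_right_cancel₀ (C_ne_zero.2 he) ?_⟩
    linear_combination t * hg + q * hw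
  by_contra! hT
  let J : Ideal D[X] := (Ideal.span {C e}).colon {g}
  have hJ (u : D[X]) : u ∈ J ↔ C e ∣ u * g := by
    rw [Submodule.mem_colon_singleton, Ideal.mem_span_singleton, smul_eq_mul]
  obtain ⟨Q, hQ, hJQ, hQT⟩ := J.exists_le_prime_disjoint T
    (Set.disjoint_left.2 fun u hu huT => hT u huT ((hJ u).1 hu))
  let P : Ideal D := Q.comap C
  let I : Finset D := s.biUnion fun f => (r f).coeffs
  have hI0 : ∃ a ∈ I, a ≠ 0 := by
    by_contra! h0
    have hr0 : ∀ f ∈ s, r f = 0 := by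
      intro f hf
      by_contra hne
      have hl := coeff_mem_coeffs (leadingCoeff_ne_zero.2 hne)
      exact leadingCoeff_ne_zero.2 hne (h0 _ (Finset.mem_biUnion.2 ⟨f, hf, hl⟩))
    have hle : Ideal.span (r '' (s : Set D[X])) ≤ ⊥ := by
      rw [Ideal.span_le]
      rintro _ ⟨f, hf, rfl⟩
      simp [hr0 f hf]
    exact he (by simpa using hle hspan)
  -- `I` generates the content of the family `r f`; a fraction `m / n` in its inverse also
  -- multiplies every `r f` into `D[X]`.
  have hu (k : ℕ) : ∃ u ∈ P.primeCompl, e ∣ u * g.coeff k := by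
    refine hD P.primeCompl P.primeCompl_le_nonZeroDivisors I hI0 (g.coeff k) e he ?_
    intro m n hn hm
    have hmI (f : D[X]) (hf : f ∈ s) : C n ∣ C m * r f := by
      rw [C_dvd_iff_dvd_coeff]
      intro i
      rw [coeff_C_mul]
      by_cases hi : (r f).coeff i = 0
      · simp [hi]
      · exact hm _ (Finset.mem_biUnion.2 ⟨f, hf, coeff_mem_coeffs hi⟩)
    obtain ⟨t, ht, h⟩ := H (C m) (C n) (C_ne_zero.2 hn) hmI
    have hdvd (f : D[X]) (hf : f ∈ s) : C (e * n) ∣ (C m * (t * g)) * r f := by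
      rw [C_mul]
      refine (mul_dvd_mul_iff_left hq).1 ?_
      obtain ⟨w, hw⟩ := h f hf
      refine ⟨t₀ * w, ?_⟩
      linear_combination -t * C m * r f * hg + t₀ * C e * hw
    obtain ⟨i, hi⟩ : ∃ i, t.coeff i ∉ P := by
      by_contra! hcon
      refine Set.disjoint_left.1 hQT ?_ ht
      have : t ∈ P.map C := Ideal.mem_map_C_iff.2 hcon
      exact Ideal.map_comap_le this
    intro a ha
    refine ⟨t.coeff i, hi, ?_⟩
    obtain ⟨f, hf, ha⟩ := Finset.mem_biUnion.1 ha
    obtain ⟨l, -, rfl⟩ := Polynomial.mem_coeffs_iff.1 ha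
    -- Kronecker's lemma is used twice: to split off `r f`, then to separate `t` from `g`.
    have h1 (j : ℕ) : e * n ∣ (t * (C (m * (r f).coeff l) * g)).coeff j := by
      have := dvd_coeff_mul_coeff ((C_dvd_iff_dvd_coeff _ _).1 (hdvd f hf)) j l
      rw [coeff_C_mul] at this
      rw [mul_left_comm, coeff_C_mul]
      convert this using 1
      ring
    have := dvd_coeff_mul_coeff h1 i k
    rw [coeff_C_mul] at this
    convert this using 1
    ring
  obtain ⟨u, hu, huk⟩ := exists_common_dvd_mul P.primeCompl (Finset.range (g.natDegree + 1)) e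
    g.coeff fun k _ => hu k
  refine hu (hJQ ((hJ _).2 ?_))
  rw [C_dvd_iff_dvd_coeff]
  intro k
  rw [coeff_C_mul]
  by_cases hk : k < g.natDegree + 1
  · exact huk k (Finset.mem_range.2 hk)
  · simp [g.coeff_eq_zero_of_natDegree_lt (show g.natDegree < k by omega)]

theorem corollaryP (D : Type*) [CommRing D] [IsDomain D] :
    IsSuperVDomain D ↔ IsSuperVDomain D[X] := by
  rw [isSuperVDomain_iff, isSuperVDomain_iff]
  refine ⟨fun h T _ => IsVDomainAt.polynomial h T, fun h S hS => (h (S.map C) ?_).of_polynomial⟩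
  rintro _ ⟨x, hx, rfl⟩
  exact mem_nonZeroDivisors_of_ne_zero (C_ne_zero.2 (nonZeroDivisors.ne_zero (hS hx)))
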